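/- Let $n\ge 0$, $A\in\mathbb R^{n\times n}$, $q\in\mathbb R^n$. Put $$\mathcal F_1=\{(x,z_1,z_2)\in(\mathbb R^n)^3: x>0,\ Ax+q>0,\ z_1>0,\ z_2>0\},\qquad \bar{\mathcal F}_1=\{(x,z_1,z_2)\in(\mathbb R^n)^3: x\ge0,\ Ax+q\ge0,\ z_1\ge0,\ z_2\ge0\}$$ (inequalities componentwise). For $y=(x,z_1,z_2)$, $y^{(0)}=(x^{(0)},z_1^{(0)},z_2^{(0)})\in\mathcal F_1$ and $\lambda\in(0,1]$ let $$H(y,y^{(0)},\lambda)=\begin{pmatrix}(1-\lambda)\big[(A+A^t)x+q-z_1-A^tz_2\big]+\lambda(x-x^{(0)})\\ Z_1x-\lambda Z_1^{(0)}x^{(0)}\\ Z_2(Ax+q)-\lambda Z_2^{(0)}(Ax^{(0)}+q)\end{pmatrix},$$ where $Z_j=\operatorname{diag}(z_j)$ and $Z_j^{(0)}=\operatorname{diag}(z_j^{(0)})$. Say that $y^{(0)}$ is regular if $0$ is a regular value of $(y,\lambda)\mapsto H(y,y^{(0)},\lambda)$ on $\mathcal F_1\times(0,1]$, i.e. the derivative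 with respect to $(y,\lambda)$ is onto at each zero. Theorem. Lebesgue-almost every $y^{(0)}\in\mathcal F_1$ is regular. For every regular $y^{(0)}\in\mathcal F_1$ the zero set $\{(y,\lambda)\in\mathcal F_1\times(0,1]: H(y,y^{(0)},\lambda)=0\}$ contains a bounded smooth curve $\Gamma$, that is, a bounded set $\Gamma=\gamma([0,\infty))$ with $\gamma$ injective, $C^\infty$ and with nowhere vanishing derivative on $[0,\infty)$, which starts at $\gamma(0)=(y^{(0)},1)$ and whose $\lambda$-component tends to $0$ as $s\to\infty$. The set of limit points of $\gamma(s)$ as $s\to\infty$ has the form $L\times\{0\}$ with $\emptyset\neq L\subseteq\bar{\mathcal F}_1$, and every $(x,z_1,z_2)\in L$ satisfies $$(A+A^t)x+q-z_1-A^tz_2=0,\qquad Z_1x=0,\qquad Z_2(Ax+q)=0 .$$ -/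

import Mathlib

open Set Filter Topology MeasureTheory
open scoped Matrix ContDiff

namespace LCPHomotopy

/-- Points `y = (x, z₁, z₂)` of `ℝⁿ × ℝⁿ × ℝⁿ`. -/
abbrev State (n : ℕ) : Type := (Fin n → ℝ) × (Fin n → ℝ) × (Fin n → ℝ)

variable {n : ℕ}

/-- `𝓕₁ = 𝓕 × ℝⁿ₊₊ × ℝⁿ₊₊`, where `𝓕 = {x | x > 0, A x + q > 0}` (all inequalities componentwise
and strict). -/
def F1 (A : Matrix (Fin n) (Fin n) ℝ) (q : Fin n → ℝ) : Set (State n) :=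
  {y | (∀ i, 0 < y.1 i) ∧ (∀ i, 0 < (A *ᵥ y.1 + q) i) ∧ (∀ i, 0 < y.2.1 i) ∧ ∀ i, 0 < y.2.2 i}

/-- `𝓕̄₁ = 𝓕̄ × ℝⁿ₊ × ℝⁿ₊`, where `𝓕̄ = {x | x ≥ 0, A x + q ≥ 0}`. -/
def F1bar (A : Matrix (Fin n) (Fin n) ℝ) (q : Fin n → ℝ) : Set (State n) :=
  {y | (∀ i, 0 ≤ y.1 i) ∧ (∀ i, 0 ≤ (A *ᵥ y.1 + q) i) ∧ (∀ i, 0 ≤ y.2.1 i) ∧ ∀ i, 0 ≤ y.2.2 i}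

/-- The homotopy function `H(y, y⁽⁰⁾, λ)`; the third argument is `λ`. -/
def H (A : Matrix (Fin n) (Fin n) ℝ) (q : Fin n → ℝ) (y y₀ : State n) (l : ℝ) : State n :=
  ((1 - l) • ((A + Aᵀ) *ᵥ y.1 + q - y.2.1 - Aᵀ *ᵥ y.2.2) + l • (y.1 - y₀.1),
   Matrix.diagonal y.2.1 *ᵥ y.1 - l • (Matrix.diagonal y₀.2.1 *ᵥ y₀.1),
   Matrix.diagonal y.2.2 *ᵥ (A *ᵥ y.1 + q)
     - l • (Matrix.diagonal y₀.2.2 *ᵥ (A *ᵥ y₀.1 + q)))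

/-- The zero set of `H_{y⁽⁰⁾}` in `𝓕₁ × (0, 1]`. -/
def zeroSet (A : Matrix (Fin n) (Fin n) ℝ) (q : Fin n → ℝ) (y₀ : State n) : Set (State n × ℝ) :=
  {p | p ∈ F1 A q ×ˢ Ioc (0 : ℝ) 1 ∧ H A q p.1 y₀ p.2 = 0}

/-- `0` is a regular value of `H_{y⁽⁰⁾} : 𝓕₁ × (0, 1] → ℝ³ⁿ`, `(y, λ) ↦ H(y, y⁽⁰⁾, λ)`: its total
derivative in `(y, λ)` is onto at every zero. (`H` is polynomial on all of `ℝ³ⁿ × ℝ`, so the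
derivative makes sense also at `λ = 1`.) -/
def ZeroIsRegularValue (A : Matrix (Fin n) (Fin n) ℝ) (q : Fin n → ℝ) (y₀ : State n) : Prop :=
  ∀ p ∈ zeroSet A q y₀,
    Function.Surjective (fderiv ℝ (fun u : State n × ℝ => H A q u.1 y₀ u.2) p)

/-- `y = (x, z₁, z₂)` solves `(A + Aᵗ) x + q - z₁ - Aᵗ z₂ = 0`, `Z₁ x = 0`, `Z₂ (A x + q) = 0`. -/
def SolvesSystem (A : Matrix (Fin n) (Fin n) ℝ) (q : Fin n → ℝ) (y : State n) : Prop :=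
  (A + Aᵀ) *ᵥ y.1 + q - y.2.1 - Aᵀ *ᵥ y.2.2 = 0 ∧
  Matrix.diagonal y.2.1 *ᵥ y.1 = 0 ∧
  Matrix.diagonal y.2.2 *ᵥ (A *ᵥ y.1 + q) = 0

/-- `γ`, restricted to `[0, ∞)`, parametrizes a smooth curve: it is smooth (one-sidedly at `0`),
injective, and has nowhere vanishing velocity. -/
def IsSmoothCurve (γ : ℝ → State n × ℝ) : Prop :=
  ContDiffOn ℝ ∞ γ (Ici 0) ∧ InjOn γ (Ici 0) ∧ ∀ s ∈ Ici (0 : ℝ), derivWithin γ (Ici 0) s ≠ 0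

/-- The limit set of `γ : [0, ∞) → ℝ³ⁿ × ℝ`: all limit points of `γ s` as `s → ∞`. -/
def limitSet (γ : ℝ → State n × ℝ) : Set (State n × ℝ) :=
  {p | MapClusterPt p atTop γ}

end LCPHomotopy

/-! Almost every start is regular because H(y, y⁰, λ) = `freePart` (y, λ) − λ · `startMap` y⁰. Hence
y⁰ fails to be regular only if `startMap` y⁰ is a critical value of λ⁻¹ • `freePart` on λ > 0. At
such a critical point the determinant of the y-derivative of `freePart` vanishes. That determinant
is analytic, and it is nonzero on `F1` at λ = 1, where it is the Jacobian of the locally invertible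
`startMap`. A Sard argument in codimension one (`measure_image_critical_eq_zero`) makes the critical
values null, and `startMapInv` carries null sets to null sets (`ae_zeroIsRegularValue`).

For a regular start the curve is an integral curve of a field spanning the kernel of the derivative
of H (`exists_zero_path`). It cannot reach λ = 0, cannot leave through λ = 1, where the start is the
only zero, and cannot close up. An accumulation point at positive level would be a regular zero,
around which the zero set is a single arc that the curve would have to traverse twice. So λ tends to
0.

This needs the zero set to be bounded (`isBounded_zeroSet`) and closed at positive levels
(`mem_zeroSet_of_mem_closure`). An unbounded sequence of x would give a recession direction d with d
≥ 0 and A d ≥ 0; pairing the first block with d excludes it, since the complementarity equations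
carry the same factor λ as the term x − x⁰. Pairing with x − x⁰ then bounds the multipliers. Limit
points solve H = 0 at λ = 0. -/

namespace LCPHomotopy

/-! ### Smooth kernel vectors from Cramer's rule. -/

section KernelField

theorem contDiff_matrix_det {X ι : Type*} [NormedAddCommGroup X] [NormedSpace ℝ X] [Fintype ι]
    [DecidableEq ι] {k : WithTop ℕ∞} {M : X → Matrix ι ι ℝ}
    (hM : ∀ i j, ContDiff ℝ k fun x => M x i j) : ContDiff ℝ k fun x => (M x).det := by
  simp only [Matrix.det_apply]
  exact ContDiff.sum fun σ _ => (contDiff_prod fun i _ => hM _ _).const_smul _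

variable {F : Type*} [NormedAddCommGroup F] [NormedSpace ℝ F] [FiniteDimensional ℝ F]

theorem contDiff_clm_det {k : WithTop ℕ∞} : ContDiff ℝ k fun T : F →L[ℝ] F => T.det := by
  let b := Module.finBasis ℝ F
  have h : (fun T : F →L[ℝ] F => T.det) =
      fun T : F →L[ℝ] F => (LinearMap.toMatrix b b (T : F →ₗ[ℝ] F)).det := by
    ext T
    rw [LinearMap.det_toMatrix]
  rw [h]
  refine contDiff_matrix_det fun i j => ?_
  simp only [LinearMap.toMatrix_apply]
  exact ((LinearMap.toContinuousLinearMap (b.coord i)).comp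
    (ContinuousLinearMap.apply ℝ F (b j))).contDiff

theorem clm_surjective_of_det_ne_zero {T : F →L[ℝ] F} (h : T.det ≠ 0) :
    Function.Surjective T := by
  have h' : IsUnit (LinearMap.det (T : F →ₗ[ℝ] F)) := isUnit_iff_ne_zero.2 h
  have := LinearMap.isUnit_iff_isUnit_det (T : F →ₗ[ℝ] F) |>.2 h'
  exact ((Module.End.isUnit_iff _).1 this).2

theorem clm_det_ne_zero_of_surjective {T : F →L[ℝ] F} (h : Function.Surjective T) :
    T.det ≠ 0 := by
  have hi : Function.Injective (T : F →ₗ[ℝ] F) := LinearMap.injective_iff_surjective.2 h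
  have := (LinearMap.isUnit_iff_isUnit_det (T : F →ₗ[ℝ] F)).1
    ((Module.End.isUnit_iff _).2 ⟨hi, h⟩)
  exact this.ne_zero

/-- Cramer's rule gives a smooth choice of a vector in the kernel of a linear map of corank one,
vanishing only where the map fails to be onto. -/
theorem exists_kernel_field : ∃ N : (F × ℝ →L[ℝ] F) → F × ℝ, ContDiff ℝ ∞ N ∧
    ∀ T : F × ℝ →L[ℝ] F, T (N T) = 0 ∧ (Function.Surjective T → N T ≠ 0) ∧
      (N T).2 = (T.comp (ContinuousLinearMap.inl ℝ F ℝ)).det := by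
  let b := Module.finBasis ℝ F
  let B : (F × ℝ →L[ℝ] F) → Matrix _ _ ℝ := fun T =>
    LinearMap.toMatrix b b (T.comp (ContinuousLinearMap.inl ℝ F ℝ) : F →ₗ[ℝ] F)
  let c : (F × ℝ →L[ℝ] F) → Fin (Module.finrank ℝ F) → ℝ := fun T i => b.repr (T (0, 1)) i
  have hentry : ∀ i v, ContDiff ℝ ∞ fun T : F × ℝ →L[ℝ] F => b.repr (T v) i := fun i v =>
    ((LinearMap.toContinuousLinearMap (b.coord i)).comp
      (ContinuousLinearMap.apply ℝ F v)).contDiff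
  have hB : ∀ i j, ContDiff ℝ ∞ fun T => B T i j := by
    intro i j
    simp only [B, LinearMap.toMatrix_apply]
    exact hentry i (b j, 0)
  have hBv : ∀ T (a : Fin (Module.finrank ℝ F) → ℝ),
      b.equivFun.symm (B T *ᵥ a) = T (b.equivFun.symm a, 0) := by
    intro T a
    have : B T *ᵥ a = b.equivFun (T (b.equivFun.symm a, 0)) := by
      have h := LinearMap.toMatrix_mulVec_repr b b
        (T.comp (ContinuousLinearMap.inl ℝ F ℝ) : F →ₗ[ℝ] F) (b.equivFun.symm a)
      have h2 : ⇑(b.repr (b.equivFun.symm a)) = a := b.equivFun.apply_symm_apply a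
      rw [h2] at h
      exact h
    rw [this, LinearEquiv.symm_apply_apply]
  have hcv : ∀ T, b.equivFun.symm (c T) = T (0, 1) := fun T =>
    b.equivFun.symm_apply_apply (T (0, 1))
  -- Writing T (u, s) = B u + s c, the identity B (cramer B c) = det B • c puts (−cramer B c, det B)
  -- in the kernel.
  refine ⟨fun T => (-b.equivFun.symm ((B T).cramer (c T)), (B T).det), ?_, fun T => ⟨?_, ?_, ?_⟩⟩
  · refine ContDiff.prodMk (ContDiff.neg ?_) (contDiff_matrix_det hB)
    simp only [Module.Basis.equivFun_symm_apply, Matrix.cramer_apply]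
    refine ContDiff.sum fun i _ => ContDiff.smul (contDiff_matrix_det fun j l => ?_) contDiff_const
    simp only [Matrix.updateCol_apply]
    split_ifs
    · exact hentry _ _
    · exact hB _ _
  · have h1 : ((-b.equivFun.symm ((B T).cramer (c T)), (B T).det) : F × ℝ)
        = -(b.equivFun.symm ((B T).cramer (c T)), 0) + (B T).det • ((0 : F), (1 : ℝ)) := by
      ext <;> simp
    beta_reduce
    rw [h1, map_add, map_neg, map_smul, ← hBv, Matrix.mulVec_cramer, map_smul, hcv]
    simp
  · intro hT hN
    have hcr : (B T).cramer (c T) = 0 :=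
      b.equivFun.symm.map_eq_zero_iff.1 (neg_eq_zero.1 (congrArg Prod.fst hN))
    have hdet : (B T).det = 0 := congrArg Prod.snd hN
    have hsurj : ∀ M : Matrix (Fin (Module.finrank ℝ F)) (Fin (Module.finrank ℝ F)) ℝ,
        Function.Surjective (M *ᵥ ·) → M.det ≠ 0 := by
      intro M hM
      have := Matrix.mulVec_surjective_iff_isUnit.1 hM
      exact ((Matrix.isUnit_iff_isUnit_det _).1 this).ne_zero
    -- If the vector vanishes, B is singular, so some column i depends on the others. Replacing it
    -- by c keeps the full range of T, yet the determinant of the new matrix is the i-th Cramer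
    -- entry, which is 0.
    have hnotinj : ∃ a, a ≠ 0 ∧ B T *ᵥ a = 0 := Matrix.exists_mulVec_eq_zero_iff.2 hdet
    obtain ⟨a, ha, hBa⟩ := hnotinj
    obtain ⟨i, hi⟩ := Function.ne_iff.1 ha
    refine hsurj ((B T).updateCol i (c T)) ?_ ?_
    · intro w
      obtain ⟨⟨u, s⟩, hu⟩ := hT (b.equivFun.symm w)
      -- Subtracting a multiple of the null vector a clears coordinate i without changing the image
      -- under B, which frees that coordinate for s.
      let u' := b.equivFun u - (b.equivFun u i / a i) • a
      have hu'i : u' i = 0 := by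
        have : a i ≠ 0 := hi
        simp [u', this]
      have hw : w = B T *ᵥ u' + s • c T := by
        apply b.equivFun.symm.injective
        rw [← hu, map_add, map_smul, Matrix.mulVec_sub, Matrix.mulVec_smul, hBa, smul_zero,
          sub_zero, hBv, hcv, LinearEquiv.symm_apply_apply, ← map_smul, ← map_add]
        simp
      refine ⟨Function.update u' i s, ?_⟩
      rw [hw]
      ext j
      simp only [Matrix.mulVec, dotProduct, Pi.add_apply, Pi.smul_apply, smul_eq_mul]
      rw [← Finset.add_sum_erase _ _ (Finset.mem_univ i),
        ← Finset.add_sum_erase _ (fun x => B T j x * u' x) (Finset.mem_univ i)]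
      simp only [Matrix.updateCol_self, Function.update_self, hu'i, mul_zero, zero_add]
      rw [add_comm, mul_comm s]
      congr 1
      refine Finset.sum_congr rfl fun l hl => ?_
      have hl : l ≠ i := Finset.ne_of_mem_erase hl
      rw [Matrix.updateCol_ne hl, Function.update_of_ne hl]
    · rw [← Matrix.cramer_apply, hcr]
      rfl
  · exact LinearMap.det_toMatrix b _

end KernelField

/-! ### Sard's theorem in codimension one. -/

section Sard

theorem exists_iteratedFDeriv_ne_zero {E : Type*} [NormedAddCommGroup E] [NormedSpace ℝ E] {h : E → ℝ} (hh : AnalyticOnNhd ℝ h univ)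
    (hne : ∃ x, h x ≠ 0) (p : E) : ∃ k, iteratedFDeriv ℝ k h p ≠ 0 := by
  by_contra! hzero
  obtain ⟨x, hx⟩ := hne
  refine hx (hh.eqOn_zero_of_preconnected_of_eventuallyEq_zero isPreconnected_univ
    (mem_univ p) ?_ (mem_univ x))
  obtain ⟨P, r, hP⟩ := hh p (mem_univ p)
  filter_upwards [Metric.eball_mem_nhds p hP.r_pos] with q hq
  have hs := hP.hasSum_sub hq
  have hz : ∀ k, P k (fun _ => q - p) = 0 := by
    intro k
    have := hP.factorial_smul (q - p) k
    rw [hzero k] at this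
    have h2 : (k.factorial : ℝ) ≠ 0 := by positivity
    simpa [h2, Nat.factorial_ne_zero] using this
  simp only [hz] at hs
  exact hs.unique hasSum_zero

variable {E F : Type*} [NormedAddCommGroup E] [NormedSpace ℝ E] [FiniteDimensional ℝ E]
  [NormedAddCommGroup F] [NormedSpace ℝ F] [FiniteDimensional ℝ F]

/-- Supplies the remaining coordinates for straightening a hypersurface with conormal ℓ: project
onto ker ℓ, then identify ker ℓ with F by dimension. -/
theorem exists_complementary_map (hd : Module.finrank ℝ E = Module.finrank ℝ F + 1)
    {ℓ : E →L[ℝ] ℝ} (hℓ : ℓ ≠ 0) : ∃ π : E →L[ℝ] F, Function.Bijective (ℓ.prod π) := by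
  have hℓ' : (ℓ : E →ₗ[ℝ] ℝ) ≠ 0 := fun h => hℓ (by ext x; exact LinearMap.congr_fun h x)
  have hker : Module.finrank ℝ (ℓ : E →ₗ[ℝ] ℝ).ker = Module.finrank ℝ F := by
    have := Module.Dual.finrank_ker_add_one_of_ne_zero hℓ'
    omega
  obtain ⟨P, hP⟩ := (ℓ : E →ₗ[ℝ] ℝ).ker.subtype.exists_leftInverse_of_injective (by simp)
  let e := LinearEquiv.ofFinrankEq _ F hker
  refine ⟨LinearMap.toContinuousLinearMap ((e : _ →ₗ[ℝ] F).comp P), ?_⟩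
  have hinj : Function.Injective
      (ℓ.prod (LinearMap.toContinuousLinearMap ((e : _ →ₗ[ℝ] F).comp P)) : E →ₗ[ℝ] ℝ × F) := by
    rw [injective_iff_map_eq_zero]
    intro x hx
    have h1 : ℓ x = 0 := congrArg Prod.fst hx
    have h2 : e (P x) = 0 := congrArg Prod.snd hx
    have h3 : P x = ⟨x, h1⟩ := LinearMap.congr_fun hP ⟨x, h1⟩
    rw [map_eq_zero_iff e e.injective, h3] at h2
    exact congrArg Subtype.val h2
  refine ⟨hinj, (LinearMap.injective_iff_surjective_of_finrank_eq_finrank ?_).1 hinj⟩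
  rw [Module.finrank_prod, Module.finrank_self, hd, add_comm]

variable [MeasurableSpace F] [BorelSpace F] (μ : Measure F) [μ.IsAddHaarMeasure]

/-- Critical values of `f` at critical points on a smooth hypersurface are negligible. -/
theorem measure_image_critical_hypersurface (hd : Module.finrank ℝ E = Module.finrank ℝ F + 1)
    {f : E → F} {g : E → ℝ} {S : Set E} {p : E} (hg : ContDiffAt ℝ 1 g p)
    (hgp : fderiv ℝ g p ≠ 0) (hgS : ∀ q ∈ S, g q = 0) (hf : ∀ q ∈ S, DifferentiableAt ℝ f q)
    (hcrit : ∀ q ∈ S, ¬ Function.Surjective (fderiv ℝ f q)) :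
    ∃ U ∈ 𝓝 p, μ (f '' (S ∩ U)) = 0 := by
  obtain ⟨π, hπ⟩ := exists_complementary_map (F := F) hd hgp
  let e : E ≃L[ℝ] ℝ × F := ContinuousLinearEquiv.ofBijective ((fderiv ℝ g p).prod π)
    (LinearMap.ker_eq_bot.2 hπ.1) (LinearMap.range_eq_top.2 hπ.2)
  have hΦ : ContDiffAt ℝ 1 (fun q => (g q, π q)) p := hg.prodMk π.contDiff.contDiffAt
  have hΦ' : HasFDerivAt (fun q => (g q, π q)) (e : E →L[ℝ] ℝ × F) p :=
    (hg.differentiableAt one_ne_zero).hasFDerivAt.prodMk π.hasFDerivAt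
  let φ := hΦ.localInverse hΦ' one_ne_zero
  have hφ : ContDiffAt ℝ 1 φ (g p, π p) := hΦ.to_localInverse hΦ' one_ne_zero
  have hleft : ∀ᶠ q in 𝓝 p, φ (g q, π q) = q :=
    (hΦ.hasStrictFDerivAt' hΦ' one_ne_zero).eventually_left_inverse
  have hdiff : ∀ᶠ q in 𝓝 p, DifferentiableAt ℝ φ (g q, π q) := by
    have h1 : ∀ᶠ u in 𝓝 (g p, π p), DifferentiableAt ℝ φ u :=
      (hφ.eventually (by simp)).mono fun u hu => hu.differentiableAt one_ne_zero
    exact hΦ.continuousAt.eventually h1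
  refine ⟨_, hleft.and hdiff, ?_⟩
  -- By the inverse function theorem for (g, π), this parametrizes {g = 0} near p by F. Thus f on
  -- the hypersurface becomes `f ∘ ψ`, a map between spaces of equal dimension whose derivative is
  -- singular because it factors through that of f.
  let ψ : F → E := fun u => φ (0, u)
  let S' := S ∩ {q | φ (g q, π q) = q ∧ DifferentiableAt ℝ φ (g q, π q)}
  have hψ : ∀ q ∈ S', ψ (π q) = q ∧ DifferentiableAt ℝ ψ (π q) := by
    rintro q ⟨hq, hq1, hq2⟩
    rw [hgS q hq] at hq1 hq2
    refine ⟨hq1, hq2.comp (π q) ?_⟩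
    fun_prop
  have himg : f '' S' = (f ∘ ψ) '' (π '' S') := by
    rw [image_image]
    exact image_congr fun q hq => congrArg f (hψ q hq).1.symm
  change μ (f '' S') = 0
  rw [himg]
  refine addHaar_image_eq_zero_of_det_fderivWithin_eq_zero μ
    (f' := fun u => fderiv ℝ (f ∘ ψ) u) ?_ ?_
  · rintro _ ⟨q, hq, rfl⟩
    refine (DifferentiableAt.comp (π q) ?_ (hψ q hq).2).hasFDerivAt.hasFDerivWithinAt
    rw [(hψ q hq).1]
    exact hf q hq.1
  · rintro _ ⟨q, hq, rfl⟩
    by_contra hne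
    have hs := clm_surjective_of_det_ne_zero hne
    rw [fderiv_comp (π q) (by rw [(hψ q hq).1]; exact hf q hq.1) (hψ q hq).2, (hψ q hq).1] at hs
    exact hcrit q hq.1 (Function.Surjective.of_comp (g := fderiv ℝ ψ (π q)) hs)

/-- A form of Sard's theorem in codimension one: if the critical points considered lie in the zero
set of a nontrivial analytic function, then their image is negligible. -/
theorem measure_image_critical_eq_zero (hd : Module.finrank ℝ E = Module.finrank ℝ F + 1)
    {f : E → F} {h : E → ℝ} {S : Set E} (hh : AnalyticOnNhd ℝ h univ) (hne : ∃ x, h x ≠ 0)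
    (hS : ∀ q ∈ S, h q = 0) (hf : ∀ q ∈ S, DifferentiableAt ℝ f q)
    (hcrit : ∀ q ∈ S, ¬ Function.Surjective (fderiv ℝ f q)) : μ (f '' S) = 0 := by
  -- Stratification by order of vanishing: on stratum k all k-th partials of h vanish, but some
  -- (k+1)-st does not.
  let St : ℕ → Set E := fun k =>
    {q ∈ S | iteratedFDeriv ℝ k h q = 0 ∧ iteratedFDeriv ℝ (k + 1) h q ≠ 0}
  have hcover : S ⊆ ⋃ k, St k := by
    intro q hq
    classical
    have hex := exists_iteratedFDeriv_ne_zero hh hne q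
    have h0 : iteratedFDeriv ℝ 0 h q = 0 := by
      ext m
      simp [hS q hq]
    obtain ⟨k, hk⟩ : ∃ k, Nat.find hex = k + 1 := Nat.exists_eq_succ_of_ne_zero fun h' =>
      (h' ▸ Nat.find_spec hex) h0
    refine mem_iUnion.2 ⟨k, hq, ?_, hk ▸ Nat.find_spec hex⟩
    by_contra hk'
    exact Nat.find_min hex (by omega) hk'
  have hloc : ∀ k, μ (f '' St k) = 0 := by
    intro k
    have hpt : ∀ p ∈ St k, ∃ U ∈ 𝓝 p, μ (f '' (St k ∩ U)) = 0 := by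
      rintro p ⟨hp, hp0, hp1⟩
      obtain ⟨m, hm⟩ : ∃ m, iteratedFDeriv ℝ (k + 1) h p m ≠ 0 := by
        by_contra! hm
        exact hp1 (by ext m; exact hm m)
      have hcd : ContDiff ℝ 1 (iteratedFDeriv ℝ k h) :=
        ContDiff.iteratedFDeriv_right (m := 1) (n := ω) (contDiff_omega_iff_analyticOnNhd.2 hh)
          le_top
      -- This k-th partial vanishes on the stratum, and its derivative at p in direction `m 0` is
      -- the nonzero (k+1)-st partial.
      have hg : ContDiff ℝ 1 fun q => iteratedFDeriv ℝ k h q (Fin.tail m) :=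
        (ContinuousMultilinearMap.apply ℝ _ ℝ (Fin.tail m)).contDiff.comp hcd
      refine measure_image_critical_hypersurface μ hd hg.contDiffAt ?_ ?_
        (fun q hq => hf q hq.1) fun q hq => hcrit q hq.1
      · intro hzero
        apply hm
        rw [iteratedFDeriv_succ_apply_left]
        have hc := ((ContinuousMultilinearMap.apply ℝ _ ℝ (Fin.tail m)).hasFDerivAt.comp p
          (hcd.differentiable one_ne_zero p).hasFDerivAt).fderiv
        have := DFunLike.congr_fun (hc.symm.trans hzero) (m 0)
        exact this
      · intro q hq
        simp [hq.2.1]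
    choose! U hU hU0 using hpt
    obtain ⟨t, hts, htc, ht⟩ := TopologicalSpace.countable_cover_nhdsWithin
      (f := U) (s := St k) fun x hx => mem_nhdsWithin_of_mem_nhds (hU x hx)
    refine measure_mono_null (t := ⋃ x ∈ t, f '' (St k ∩ U x)) ?_
      ((measure_biUnion_null_iff htc).2 fun x hx => hU0 x (hts hx))
    rintro _ ⟨q, hq, rfl⟩
    obtain ⟨x, hx, hqx⟩ := mem_iUnion₂.1 (ht hq)
    exact mem_iUnion₂.2 ⟨x, hx, q, ⟨hq, hqx⟩, rfl⟩
  refine measure_mono_null (image_mono hcover) ?_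
  rw [image_iUnion]
  exact measure_iUnion_null hloc

end Sard

/-! ### Global integral curves of bounded Lipschitz fields. -/

section Flow

variable {E : Type*} [NormedAddCommGroup E] [NormedSpace ℝ E]

theorem eq_of_solution {V : E → E} {K : NNReal} (hV : LipschitzWith K V) {c d : ℝ → E}
    (hc : ∀ t, HasDerivAt c (V (c t)) t) (hd : ∀ t, HasDerivAt d (V (d t)) t) {t₀ : ℝ}
    (h : c t₀ = d t₀) : c = d :=
  ODE_solution_unique_univ (v := fun _ => V) (s := fun _ => univ) (K := K)
    (fun _ => hV.lipschitzOnWith) (fun t => ⟨hc t, mem_univ _⟩) (fun t => ⟨hd t, mem_univ _⟩) h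

theorem solution_shift {V : E → E} {c : ℝ → E} (hc : ∀ t, HasDerivAt c (V (c t)) t) (a : ℝ)
    (t : ℝ) : HasDerivAt (fun s => c (s + a)) (V (c (t + a))) t :=
  (hc (t + a)).comp_add_const t a

theorem contDiff_of_solution {V : E → E} (hV : ContDiff ℝ ∞ V) {c : ℝ → E}
    (hc : ∀ t, HasDerivAt c (V (c t)) t) : ContDiff ℝ ∞ c := by
  refine contDiff_infty.2 fun k => ?_
  induction k with
  | zero => exact contDiff_zero.2 (continuous_iff_continuousAt.2 fun t => (hc t).continuousAt)
  | succ k ih =>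
    have hderiv : ContDiff ℝ k (deriv c) := by
      rw [show deriv c = V ∘ c from funext fun t => (hc t).deriv]
      exact (hV.of_le (by exact_mod_cast le_top)).comp ih
    have : ContDiff ℝ ((k : WithTop ℕ∞) + 1) c :=
      contDiff_succ_iff_deriv.2 ⟨fun t => (hc t).differentiableAt, by simp, hderiv⟩
    exact_mod_cast this

/-- Since V is bounded by C and Lipschitz everywhere, Picard–Lindelöf applies on intervals of any
length; uniqueness glues the pieces. -/
theorem exists_global_solution [CompleteSpace E] {V : E → E} {K C : NNReal}
    (hV : LipschitzWith K V) (hC : ∀ x, ‖V x‖ ≤ C) (p : E) :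
    ∃ c : ℝ → E, c 0 = p ∧ ∀ t, HasDerivAt c (V (c t)) t := by
  have hloc : ∀ N : ℕ, ∃ c : ℝ → E, c 0 = p ∧
      ∀ t ∈ Ioo (-((N : ℝ) + 1)) (N + 1), HasDerivAt c (V (c t)) t := by
    intro N
    have hN : (0 : ℝ) ≤ N := N.cast_nonneg
    have h0 : (0 : ℝ) ∈ Icc (-((N : ℝ) + 1)) (N + 1) := ⟨by linarith, by linarith⟩
    have hPL : IsPicardLindelof (fun _ => V) (⟨0, h0⟩ : Icc (-((N : ℝ) + 1)) (N + 1)) p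
        (C * (N + 1)) 0 C K :=
      IsPicardLindelof.of_time_independent (fun x _ => hC x) hV.lipschitzOnWith (by simp)
    obtain ⟨c, hc0, hc⟩ := hPL.exists_eq_forall_mem_Icc_hasDerivWithinAt₀
    exact ⟨c, hc0, fun t ht => (hc t (Ioo_subset_Icc_self ht)).hasDerivAt
      (Icc_mem_nhds ht.1 ht.2)⟩
  choose c hc0 hc using hloc
  have huniq : ∀ M N : ℕ, M ≤ N → ∀ t : ℝ, |t| < M + 1 → c M t = c N t := by
    intro M N hMN t ht
    have hMN' : (M : ℝ) ≤ N := by exact_mod_cast hMN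
    have hM : (0 : ℝ) ≤ M := M.cast_nonneg
    refine ODE_solution_unique_of_mem_Ioo (v := fun _ => V) (s := fun _ => univ) (K := K)
      (a := -((M : ℝ) + 1)) (b := M + 1) (t₀ := 0) (fun _ _ => hV.lipschitzOnWith)
      ⟨by linarith, by linarith⟩ (fun s hs => ⟨hc M s hs, mem_univ _⟩)
      (fun s hs => ⟨hc N s ⟨by linarith [hs.1], by linarith [hs.2]⟩, mem_univ _⟩)
      (by rw [hc0, hc0]) ?_
    exact abs_lt.1 ht
  -- The N-th piece lives on |t| < N + 1, so near t all the pieces used agree with the one of index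
  -- ⌈|t|⌉₊ + 1.
  refine ⟨fun t => c ⌈|t|⌉₊ t, hc0 _, fun t => ?_⟩
  have ht := Nat.le_ceil |t|
  have hev : (fun s => c ⌈|s|⌉₊ s) =ᶠ[𝓝 t] c (⌈|t|⌉₊ + 1) := by
    have : ∀ᶠ s in 𝓝 t, |s| < (⌈|t|⌉₊ + 1 : ℝ) :=
      continuous_abs.continuousAt.eventually (gt_mem_nhds (by linarith))
    filter_upwards [this] with s hs
    refine huniq _ _ ?_ s (by linarith [Nat.le_ceil |s|])
    exact Nat.ceil_le.2 (by push_cast; linarith)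
  have hd := hc (⌈|t|⌉₊ + 1) t (abs_lt.1 (by push_cast; linarith))
  have := hd.congr_of_eventuallyEq hev
  rwa [← hev.self_of_nhds] at this

end Flow

/-! ### Following a curve of regular zeros. -/

section Path

theorem eventually_neg_snd {F : Type*} [NormedAddCommGroup F] [NormedSpace ℝ F]
    {c : ℝ → F × ℝ} {v : F × ℝ} {t : ℝ} (hc : HasDerivAt c v t)
    (hv : v.2 < 0) : (∀ᶠ s in 𝓝[>] t, (c s).2 < (c t).2) ∧ ∀ᶠ s in 𝓝[<] t, (c t).2 < (c s).2 := by
  have hd : HasDerivAt (fun s => (c s).2) v.2 t := hc.snd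
  have hs := hd.tendsto_slope.eventually (gt_mem_nhds hv)
  constructor
  · have h1 := hs.filter_mono (nhdsWithin_mono t fun s (hs : t < s) => ne_of_gt hs)
    filter_upwards [h1, self_mem_nhdsWithin] with s h1 h2
    rw [slope_def_field, div_lt_iff₀ (sub_pos.2 h2)] at h1
    linarith
  · have h1 := hs.filter_mono (nhdsWithin_mono t fun s (hs : s < t) => ne_of_lt hs)
    filter_upwards [h1, self_mem_nhdsWithin] with s h1 h2
    have h2 : s < t := h2
    rw [slope_def_field, div_lt_iff_of_neg (sub_neg.2 h2)] at h1
    linarith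

variable {F : Type*} [NormedAddCommGroup F] [NormedSpace ℝ F] [FiniteDimensional ℝ F]

/-- Near a regular zero `p` of `G`, the zero set of `G` is an arc of any integral curve through `p`
of a field tangent to the fibres of `G` and not vanishing at `p`. -/
theorem eventually_mem_range_of_solution {G : F × ℝ → F} (hG : ContDiff ℝ ∞ G) {p : F × ℝ}
    (hreg : Function.Surjective (fderiv ℝ G p)) {V : F × ℝ → F × ℝ}
    (hV : ContDiff ℝ ∞ V) (hGV : ∀ q, fderiv ℝ G q (V q) = 0) (hVp : V p ≠ 0) {c : ℝ → F × ℝ}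
    (hc : ∀ t, HasDerivAt c (V (c t)) t) (hc0 : c 0 = p) :
    ∀ᶠ q in 𝓝 p, G q = G p → ∃ t, |t| < 1 ∧ c t = q := by
  -- The kernel of the derivative of G at p is the line through V p. Hence (G, ℓ) is a local
  -- diffeomorphism at p, and ℓ is a coordinate on the zero set and along c.
  obtain ⟨ℓ, hℓ⟩ : ∃ ℓ : F × ℝ →L[ℝ] ℝ, ℓ (V p) ≠ 0 := by
    by_contra! h
    exact hVp (SeparatingDual.eq_zero_of_forall_dual_eq_zero h)
  have hinj : Function.Injective ((fderiv ℝ G p).prod ℓ : F × ℝ →ₗ[ℝ] F × ℝ) := by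
    have hrank : Module.finrank ℝ (fderiv ℝ G p : F × ℝ →ₗ[ℝ] F).ker = 1 := by
      have h1 := LinearMap.finrank_range_add_finrank_ker (fderiv ℝ G p : F × ℝ →ₗ[ℝ] F)
      rw [LinearMap.range_eq_top.2 hreg, finrank_top, Module.finrank_prod,
        Module.finrank_self] at h1
      omega
    rw [injective_iff_map_eq_zero]
    intro w hw
    have h1 : fderiv ℝ G p w = 0 := congrArg Prod.fst hw
    have h2 : ℓ w = 0 := congrArg Prod.snd hw
    obtain ⟨a, ha⟩ := (finrank_eq_one_iff_of_nonzero'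
      (⟨V p, hGV p⟩ : (fderiv ℝ G p : F × ℝ →ₗ[ℝ] F).ker)
      (fun h => hVp (congrArg Subtype.val h))).1 hrank ⟨w, h1⟩
    have ha' : a • V p = w := congrArg Subtype.val ha
    rw [← ha', map_smul, smul_eq_mul, mul_eq_zero, or_iff_left hℓ] at h2
    rw [← ha', h2, zero_smul]
  let e : (F × ℝ) ≃L[ℝ] (F × ℝ) := ContinuousLinearEquiv.ofBijective ((fderiv ℝ G p).prod ℓ)
    (LinearMap.ker_eq_bot.2 hinj)
    (LinearMap.range_eq_top.2 (LinearMap.injective_iff_surjective.1 hinj))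
  have hΨ : HasStrictFDerivAt (fun q => (G q, ℓ q)) (e : (F × ℝ) →L[ℝ] (F × ℝ)) p :=
    (hG.contDiffAt.hasStrictFDerivAt (by simp)).prodMk ℓ.hasStrictFDerivAt
  have hleft := hΨ.eventually_left_inverse
  have hcd := contDiff_of_solution hV hc
  have hconst : ∀ t, G (c t) = G p := by
    have hd : ∀ t, HasDerivAt (fun s => G (c s)) 0 t := by
      intro t
      have := ((hG.differentiable (by simp) (c t)).hasFDerivAt.comp_hasDerivAt t (hc t))
      rwa [hGV] at this
    intro t
    rw [← hc0]
    exact is_const_of_deriv_eq_zero (fun t => (hd t).differentiableAt) (fun t => (hd t).deriv) t 0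
  -- The curve c attains every value of ℓ near ℓ p at small times; local injectivity of (G, ℓ) then
  -- places each nearby point of the fibre on c.
  have hmap : map (fun t => ℓ (c t)) (𝓝 0) = 𝓝 (ℓ p) := by
    have hd : HasStrictDerivAt (fun t => ℓ (c t)) (ℓ (V p)) 0 := by
      have h1 : HasStrictDerivAt c (V p) 0 := by
        have := hcd.contDiffAt (x := (0 : ℝ)) |>.hasStrictDerivAt (by simp)
        rwa [(hc 0).deriv, hc0] at this
      exact ℓ.hasStrictFDerivAt.comp_hasStrictDerivAt 0 h1
    have := hd.map_nhds_eq hℓ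
    rwa [hc0] at this
  have hT : {t : ℝ | |t| < 1 ∧ hΨ.localInverse _ _ _ (G (c t), ℓ (c t)) = c t} ∈ 𝓝 0 := by
    refine Filter.inter_mem (continuous_abs.continuousAt.eventually (gt_mem_nhds (by simp))) ?_
    have h1 : Tendsto c (𝓝 0) (𝓝 p) := hc0 ▸ hcd.continuous.continuousAt
    exact h1.eventually hleft
  have himg : (fun t => ℓ (c t)) '' {t : ℝ | |t| < 1 ∧
      hΨ.localInverse _ _ _ (G (c t), ℓ (c t)) = c t} ∈ 𝓝 (ℓ p) :=
    hmap ▸ image_mem_map hT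
  filter_upwards [hleft, ℓ.continuous.continuousAt.eventually himg] with q hq ⟨t, ht, hℓt⟩ hGq
  refine ⟨t, ht.1, ?_⟩
  rw [← hq, ← ht.2, hconst, hGq]
  exact congrArg (fun a => hΨ.localInverse _ _ _ (G p, a)) hℓt

/-- The kernel field is multiplied by three factors: a bump equal to 1 on Z for compact support, λ
so that level 0 consists of rest points, and −D so that the level component at p₀ is −D² < 0. -/
theorem exists_tangent_field {G : F × ℝ → F} (hG : ContDiff ℝ ∞ G) {Z : Set (F × ℝ)}
    (hZ : Bornology.IsBounded Z) {p₀ : F × ℝ} (hp₀ : p₀ ∈ Z) (hp₀2 : p₀.2 = 1)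
    (hdet : ((fderiv ℝ G p₀).comp (ContinuousLinearMap.inl ℝ F ℝ)).det ≠ 0) :
    ∃ V : F × ℝ → F × ℝ, ContDiff ℝ ∞ V ∧ HasCompactSupport V ∧
      (∀ p, fderiv ℝ G p (V p) = 0) ∧
      (∀ p ∈ Z, 0 < p.2 → Function.Surjective (fderiv ℝ G p) → V p ≠ 0) ∧
      (∀ p, p.2 = 0 → V p = 0) ∧ (V p₀).2 < 0 := by
  obtain ⟨N, hN, hN'⟩ := exists_kernel_field (F := F)
  obtain ⟨R, hR, hZR⟩ := hZ.subset_closedBall_lt 0 0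
  let χ : ContDiffBump (0 : F × ℝ) := ⟨R, R + 1, hR, by linarith⟩
  let D := ((fderiv ℝ G p₀).comp (ContinuousLinearMap.inl ℝ F ℝ)).det
  have hχ : ∀ p ∈ Z, χ p = 1 := fun p hp => χ.one_of_mem_closedBall (hZR hp)
  refine ⟨fun p => χ p • ((-D * p.2) • N (fderiv ℝ G p)), ?_, ?_, ?_, ?_, ?_, ?_⟩
  · refine ContDiff.smul χ.contDiff (ContDiff.smul (contDiff_const.mul contDiff_snd) ?_)
    exact hN.comp (hG.fderiv_right (by simp))
  · exact χ.hasCompactSupport.smul_right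
  · intro p
    rw [map_smul, map_smul, (hN' _).1, smul_zero, smul_zero]
  · intro p hp hp2 hs
    beta_reduce
    rw [hχ p hp, one_smul]
    exact smul_ne_zero (mul_ne_zero (neg_ne_zero.2 hdet) hp2.ne') ((hN' _).2.1 hs)
  · intro p hp
    simp [hp]
  · have : (N (fderiv ℝ G p₀)).2 = D := (hN' _).2.2
    simp only [hχ p₀ hp₀, hp₀2, one_smul, mul_one, Prod.smul_snd, this, smul_eq_mul, neg_mul]
    exact neg_neg_of_pos (mul_self_pos.2 hdet)

/-- Path following: the zero set of `G` in `U × (0, 1]` contains a smooth curve that starts at its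
only point at level `1` and whose level tends to `0`. -/
theorem exists_zero_path {G : F × ℝ → F} (hG : ContDiff ℝ ∞ G) {U : Set F} (hU : IsOpen U)
    {Z : Set (F × ℝ)} (hZdef : ∀ p, p ∈ Z ↔ p.1 ∈ U ∧ 0 < p.2 ∧ p.2 ≤ 1 ∧ G p = 0)
    {p₀ : F × ℝ} (hp₀ : p₀ ∈ Z) (hp₀2 : p₀.2 = 1) (huniq : ∀ p ∈ Z, p.2 = 1 → p = p₀)
    (hreg : ∀ p ∈ Z, Function.Surjective (fderiv ℝ G p))
    (hdet : ((fderiv ℝ G p₀).comp (ContinuousLinearMap.inl ℝ F ℝ)).det ≠ 0)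
    (hbdd : Bornology.IsBounded Z) (hclosed : ∀ p ∈ closure Z, 0 < p.2 → p ∈ Z) :
    ∃ γ : ℝ → F × ℝ, ContDiff ℝ ∞ γ ∧ InjOn γ (Ici 0) ∧ (∀ s ∈ Ici (0 : ℝ), deriv γ s ≠ 0) ∧
      (∀ s ∈ Ici (0 : ℝ), γ s ∈ Z) ∧ γ 0 = p₀ ∧ Tendsto (fun s => (γ s).2) atTop (𝓝 0) := by
  obtain ⟨V, hV, hVc, hGV, hVne, hV0, hVp₀⟩ := exists_tangent_field hG hbdd hp₀ hp₀2 hdet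
  obtain ⟨K, hK⟩ := hV.lipschitzWith_of_hasCompactSupport hVc (by simp)
  obtain ⟨C, hC⟩ := hVc.exists_bound_of_continuous hV.continuous
  have hsol := exists_global_solution (C := C.toNNReal) hK
    fun x => (hC x).trans (Real.le_coe_toNNReal C)
  obtain ⟨γ, hγ0, hγ⟩ := hsol p₀
  have hcd := contDiff_of_solution hV hγ
  have hcont := hcd.continuous
  have hGγ : ∀ t, G (γ t) = 0 := by
    have hd : ∀ t, HasDerivAt (fun s => G (γ s)) 0 t := by
      intro t
      have := (hG.differentiable (by simp) (γ t)).hasFDerivAt.comp_hasDerivAt t (hγ t)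
      rwa [hGV] at this
    intro t
    have := is_const_of_deriv_eq_zero (fun t => (hd t).differentiableAt) (fun t => (hd t).deriv) t 0
    rw [this, hγ0]
    exact ((hZdef p₀).1 hp₀).2.2.2
  -- Level 0 consists of rest points, and uniqueness forbids a nonconstant solution from meeting
  -- one.
  have hne0 : ∀ t, (γ t).2 ≠ 0 := by
    intro t ht
    have hcst : ∀ s, HasDerivAt (fun _ : ℝ => γ t) (V (γ t)) s := by
      intro s
      rw [hV0 _ ht]
      exact hasDerivAt_const s _
    have := congrFun (eq_of_solution hK hγ hcst (t₀ := t) rfl) 0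
    rw [← this, hγ0, hp₀2] at ht
    exact one_ne_zero ht
  have hpos : ∀ t, 0 < (γ t).2 := by
    intro t
    by_contra! h
    have h0 : (0 : ℝ) ≤ (γ 0).2 := by rw [hγ0, hp₀2]; exact zero_le_one
    obtain ⟨s, -, hs⟩ := isPreconnected_univ.intermediate_value (mem_univ t) (mem_univ 0)
      (continuous_snd.comp hcont).continuousOn ⟨h, h0⟩
    exact hne0 s hs
  -- The times spent in Z form a closed set, as levels stay positive. It is also open to the right:
  -- U is open, and at level 1 the point is p₀, where the level strictly decreases.
  have hmem : ∀ t, 0 ≤ t → γ t ∈ Z := by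
    intro T hT
    have hcl : IsClosed (γ ⁻¹' Z) := by
      have : γ ⁻¹' Z = γ ⁻¹' closure Z := by
        ext t
        exact ⟨fun h => subset_closure h, fun h => hclosed _ h (hpos t)⟩
      rw [this]
      exact isClosed_closure.preimage hcont
    refine (hcl.inter isClosed_Icc).Icc_subset_of_forall_mem_nhdsWithin (a := 0) (b := T)
      (by rw [mem_preimage, hγ0]; exact hp₀) ?_ ⟨hT, le_rfl⟩
    rintro t ⟨ht, -⟩
    obtain ⟨htU, -, ht1, -⟩ := (hZdef _).1 ht
    have hevU : ∀ᶠ s in 𝓝[>] t, (γ s).1 ∈ U :=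
      ((continuous_fst.comp hcont).continuousAt.eventually (hU.mem_nhds htU)).filter_mono
        nhdsWithin_le_nhds
    have hev1 : ∀ᶠ s in 𝓝[>] t, (γ s).2 < 1 := by
      rcases ht1.lt_or_eq with h | h
      · exact ((continuous_snd.comp hcont).continuousAt.eventually (gt_mem_nhds h)).filter_mono
          nhdsWithin_le_nhds
      · have hd := hγ t
        rw [huniq _ ht h] at hd
        have := (eventually_neg_snd hd hVp₀).1
        rwa [h] at this
    filter_upwards [hevU, hev1] with s h1 h2
    exact (hZdef _).2 ⟨h1, hpos s, h2.le, hGγ s⟩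
  -- A return to p₀ would have levels above 1 just before it.
  have hlt : ∀ t, 0 < t → γ t ≠ p₀ := by
    intro t ht h
    have hd := hγ t
    rw [h] at hd
    have h1 := (eventually_neg_snd hd hVp₀).2
    rw [h, hp₀2] at h1
    obtain ⟨s, hs1, hs2⟩ := (h1.and (Ioo_mem_nhdsLT ht)).exists
    exact absurd ((hZdef _).1 (hmem s hs2.1.le)).2.2.1 (not_le.2 hs1)
  have hperiod : ∀ a b, a < b → γ a ≠ γ b := by
    intro a b hab h
    have := eq_of_solution hK hγ (solution_shift hγ (b - a)) (t₀ := a) (by simpa using h)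
    have h0 := congrFun this 0
    rw [hγ0, zero_add] at h0
    exact hlt _ (sub_pos.2 hab) h0.symm
  refine ⟨γ, hcd, ?_, ?_, hmem, hγ0, ?_⟩
  · intro a _ b _ hab
    rcases lt_trichotomy a b with h | h | h
    · exact absurd hab (hperiod a b h)
    · exact h
    · exact absurd hab.symm (hperiod b a h)
  · intro s hs
    rw [(hγ s).deriv]
    exact hVne _ (hmem s hs) (hpos s) (hreg _ (hmem s hs))
  · rw [Metric.tendsto_atTop']
    by_contra! hcon
    obtain ⟨ε, hε, hcon⟩ := hcon
    have hfreq : ∃ᶠ s in atTop, γ s ∈ closure Z ∩ {p | ε ≤ p.2} := by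
      rw [frequently_atTop]
      intro a
      obtain ⟨s, hs, hs2⟩ := hcon (max a 0)
      refine ⟨s, ((le_max_left _ _).trans_lt hs).le,
        subset_closure (hmem s ((le_max_right _ _).trans hs.le)), ?_⟩
      rwa [Real.dist_eq, sub_zero, abs_of_pos (hpos s)] at hs2
    have hcpt : IsCompact (closure Z ∩ {p | ε ≤ p.2}) :=
      hbdd.isCompact_closure.inter_right (isClosed_le continuous_const continuous_snd)
    obtain ⟨p, ⟨hpZ, hpε⟩, hp⟩ := hcpt.exists_mapClusterPt_of_frequently hfreq
    have hpZ := hclosed p hpZ (hε.trans_le hpε)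
    -- Visits of γ near p at times a and b ≥ a + 2 both lie on the arc c(−1, 1). So c is γ shifted
    -- by a − τ and also by b − σ, and these differ because |τ|, |σ| < 1: γ would repeat a point.
    obtain ⟨c, hc0, hc⟩ := hsol p
    have hnear := eventually_mem_range_of_solution hG (hreg p hpZ) hV hGV
      (hVne p hpZ (hε.trans_le hpε) (hreg p hpZ)) hc hc0
    have hfr := (mapClusterPt_iff_frequently.1 hp) _ hnear
    rw [frequently_atTop] at hfr
    obtain ⟨a, -, ha⟩ := hfr 0
    obtain ⟨b, hb, hb'⟩ := hfr (a + 2)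
    have hGp : G p = 0 := ((hZdef p).1 hpZ).2.2.2
    obtain ⟨τ, hτ, hτa⟩ := ha ((hGγ a).trans hGp.symm)
    obtain ⟨σ, hσ, hσb⟩ := hb' ((hGγ b).trans hGp.symm)
    have e1 := eq_of_solution hK hc (solution_shift hγ (a - τ)) (t₀ := τ) (by simpa using hτa)
    have e2 := eq_of_solution hK hc (solution_shift hγ (b - σ)) (t₀ := σ) (by simpa using hσb)
    have e3 := congrFun (e1.symm.trans e2) 0
    simp only [zero_add] at e3
    rw [abs_lt] at hτ hσ
    exact hperiod _ _ (by linarith) e3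

end Path

/-! ### The homotopy and its dependence on the starting point. -/

section LCP

variable {n : ℕ} (A : Matrix (Fin n) (Fin n) ℝ) (q : Fin n → ℝ)

/-- The part of `H` that does not involve the starting point. -/
def freePart (p : State n × ℝ) : State n :=
  ((1 - p.2) • ((A + Aᵀ) *ᵥ p.1.1 + q - p.1.2.1 - Aᵀ *ᵥ p.1.2.2) + p.2 • p.1.1,
   Matrix.diagonal p.1.2.1 *ᵥ p.1.1, Matrix.diagonal p.1.2.2 *ᵥ (A *ᵥ p.1.1 + q))

/-- The starting point enters `H` only through `startMap`. -/
def startMap (y : State n) : State n :=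
  (y.1, Matrix.diagonal y.2.1 *ᵥ y.1, Matrix.diagonal y.2.2 *ᵥ (A *ᵥ y.1 + q))

/-- The inverse of `startMap` on `F1`. -/
noncomputable def startMapInv (u : State n) : State n :=
  (u.1, fun i => u.2.1 i / u.1 i, fun i => u.2.2 i / (A *ᵥ u.1 + q) i)

/-- An open set containing the image of `F1` under `startMap`, on which `startMapInv` is smooth. -/
def startTarget : Set (State n) :=
  {u | (∀ i, 0 < u.1 i) ∧ ∀ i, 0 < (A *ᵥ u.1 + q) i}

variable {A q}

theorem H_eq_freePart_sub (y y₀ : State n) (l : ℝ) :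
    H A q y y₀ l = freePart A q (y, l) - l • startMap A q y₀ := by
  simp only [H, freePart, startMap, smul_sub, Prod.smul_mk, Prod.mk_sub_mk, add_sub_assoc]

theorem freePart_one (y : State n) : freePart A q (y, 1) = startMap A q y := by
  simp [freePart, startMap]

theorem startMapInv_startMap {y : State n} (hy : y ∈ F1 A q) :
    startMapInv A q (startMap A q y) = y := by
  obtain ⟨hx, hw, -, -⟩ := hy
  refine Prod.ext rfl (Prod.ext (funext fun i => ?_) (funext fun i => ?_))
  · simp only [startMapInv, startMap, Matrix.mulVec_diagonal]
    exact mul_div_cancel_right₀ _ (hx i).ne'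
  · simp only [startMapInv, startMap, Matrix.mulVec_diagonal]
    exact mul_div_cancel_right₀ _ (hw i).ne'

theorem contDiff_mulVec {X : Type*} [NormedAddCommGroup X] [NormedSpace ℝ X] {k : WithTop ℕ∞}
    (B : Matrix (Fin n) (Fin n) ℝ) {f : X → Fin n → ℝ} (hf : ContDiff ℝ k f) :
    ContDiff ℝ k fun x => B *ᵥ f x :=
  (LinearMap.toContinuousLinearMap B.mulVecLin).contDiff.comp hf

theorem contDiff_diagonal_mulVec {X : Type*} [NormedAddCommGroup X] [NormedSpace ℝ X]
    {k : WithTop ℕ∞} {f g : X → Fin n → ℝ} (hf : ContDiff ℝ k f) (hg : ContDiff ℝ k g) :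
    ContDiff ℝ k fun x => Matrix.diagonal (f x) *ᵥ g x := by
  refine contDiff_pi.2 fun i => ?_
  simp only [Matrix.mulVec_diagonal]
  exact (contDiff_pi.1 hf i).mul (contDiff_pi.1 hg i)

theorem contDiff_freePart {k : WithTop ℕ∞} : ContDiff ℝ k (freePart A q) := by
  have hx : ContDiff ℝ k fun p : State n × ℝ => p.1.1 := by fun_prop
  have h1 : ContDiff ℝ k fun p : State n × ℝ => p.1.2.1 := by fun_prop
  have h2 : ContDiff ℝ k fun p : State n × ℝ => p.1.2.2 := by fun_prop
  have hl : ContDiff ℝ k fun p : State n × ℝ => p.2 := by fun_prop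
  refine ContDiff.prodMk ?_ (ContDiff.prodMk (contDiff_diagonal_mulVec h1 hx)
    (contDiff_diagonal_mulVec h2 ((contDiff_mulVec A hx).add contDiff_const)))
  exact ((contDiff_const.sub hl).smul ((((contDiff_mulVec _ hx).add contDiff_const).sub h1).sub
    (contDiff_mulVec _ h2))).add (hl.smul hx)

theorem contDiff_homotopy {k : WithTop ℕ∞} (y₀ : State n) :
    ContDiff ℝ k fun u : State n × ℝ => H A q u.1 y₀ u.2 := by
  simp only [H_eq_freePart_sub]
  exact contDiff_freePart.sub (contDiff_snd.smul contDiff_const)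

theorem isOpen_F1 : IsOpen (F1 A q) := by
  have hw : Continuous fun y : State n => A *ᵥ y.1 + q :=
    (contDiff_mulVec A contDiff_fst (k := 0)).continuous.add continuous_const
  simp only [F1, ofPred_and, ofPred_forall]
  refine ((isOpen_iInter_of_finite fun i => ?_).inter ((isOpen_iInter_of_finite fun i => ?_).inter
    ((isOpen_iInter_of_finite fun i => ?_).inter (isOpen_iInter_of_finite fun i => ?_))))
  · exact isOpen_lt continuous_const (by fun_prop)
  · exact isOpen_lt continuous_const ((continuous_apply i).comp hw)
  · exact isOpen_lt continuous_const (by fun_prop)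
  · exact isOpen_lt continuous_const (by fun_prop)

theorem isOpen_startTarget : IsOpen (startTarget A q) := by
  have hw : Continuous fun y : State n => A *ᵥ y.1 + q :=
    (contDiff_mulVec A contDiff_fst (k := 0)).continuous.add continuous_const
  simp only [startTarget, ofPred_and, ofPred_forall]
  refine (isOpen_iInter_of_finite fun i => ?_).inter (isOpen_iInter_of_finite fun i => ?_)
  · exact isOpen_lt continuous_const (by fun_prop)
  · exact isOpen_lt continuous_const ((continuous_apply i).comp hw)

theorem isClosed_F1bar : IsClosed (F1bar A q) := by
  have hw : Continuous fun y : State n => A *ᵥ y.1 + q :=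
    (contDiff_mulVec A contDiff_fst (k := 0)).continuous.add continuous_const
  simp only [F1bar, ofPred_and, ofPred_forall]
  refine ((isClosed_iInter fun i => ?_).inter ((isClosed_iInter fun i => ?_).inter
    ((isClosed_iInter fun i => ?_).inter (isClosed_iInter fun i => ?_))))
  · exact isClosed_le continuous_const (by fun_prop)
  · exact isClosed_le continuous_const ((continuous_apply i).comp hw)
  · exact isClosed_le continuous_const (by fun_prop)
  · exact isClosed_le continuous_const (by fun_prop)

theorem differentiableOn_startMapInv :
    DifferentiableOn ℝ (startMapInv A q) (startTarget A q) := by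
  intro u hu
  refine DifferentiableAt.differentiableWithinAt ?_
  have hw : Differentiable ℝ fun y : State n => A *ᵥ y.1 + q :=
    ((contDiff_mulVec A contDiff_fst (k := 1)).differentiable one_ne_zero).add_const q
  refine DifferentiableAt.prodMk (by fun_prop) (DifferentiableAt.prodMk ?_ ?_)
  · refine differentiableAt_pi.2 fun i => ?_
    have h1 : DifferentiableAt ℝ (fun v : State n => v.2.1 i) u := by fun_prop
    have h2 : DifferentiableAt ℝ (fun v : State n => v.1 i) u := by fun_prop
    simp only [div_eq_mul_inv]
    exact h1.mul (h2.fun_inv (hu.1 i).ne')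
  · refine differentiableAt_pi.2 fun i => ?_
    have h1 : DifferentiableAt ℝ (fun v : State n => v.2.2 i) u := by fun_prop
    simp only [div_eq_mul_inv]
    exact h1.mul ((differentiableAt_pi.1 (hw u) i).fun_inv (hu.2 i).ne')

theorem startMap_mem {y : State n} (hy : y ∈ F1 A q) :
    startMap A q y ∈ startTarget A q :=
  ⟨hy.1, hy.2.1⟩

/-- At λ = 1 `freePart` is `startMap`, and the chain rule applied to its differentiable left inverse
makes the derivative injective. -/
theorem det_fderiv_freePart_ne_zero {y : State n} (hy : y ∈ F1 A q) :
    ((fderiv ℝ (freePart A q) (y, 1)).comp (ContinuousLinearMap.inl ℝ (State n) ℝ)).det ≠ 0 := by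
  apply clm_det_ne_zero_of_surjective
  have hinv : HasFDerivAt (startMapInv A q) (fderiv ℝ (startMapInv A q) (startMap A q y))
      (startMap A q y) :=
    (differentiableOn_startMapInv.differentiableAt
      (isOpen_startTarget.mem_nhds (startMap_mem hy))).hasFDerivAt
  have hfree : HasFDerivAt (startMap A q)
      ((fderiv ℝ (freePart A q) (y, 1)).comp (ContinuousLinearMap.inl ℝ (State n) ℝ)) y := by
    have h1 : HasFDerivAt (freePart A q) (fderiv ℝ (freePart A q) (y, 1)) (y, 1) :=
      ((contDiff_freePart (k := 1)).differentiable one_ne_zero _).hasFDerivAt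
    have h2 := HasFDerivAt.comp (f := fun v : State n => (v, (1 : ℝ))) y h1
      (hasFDerivAt_prodMk_left y (1 : ℝ))
    refine h2.congr_of_eventuallyEq (Eventually.of_forall fun v => ?_)
    exact (freePart_one v).symm
  have hcomp := hinv.comp y hfree
  have hid : HasFDerivAt (startMapInv A q ∘ startMap A q)
      (ContinuousLinearMap.id ℝ (State n)) y :=
    (hasFDerivAt_id y).congr_of_eventuallyEq
      ((isOpen_F1.eventually_mem hy).mono fun v hv => startMapInv_startMap hv)
  have heq := hcomp.unique hid
  have hinj : Function.Injective ((fderiv ℝ (freePart A q) (y, 1)).comp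
      (ContinuousLinearMap.inl ℝ (State n) ℝ) : State n →ₗ[ℝ] State n) :=
    Function.LeftInverse.injective (g := fderiv ℝ (startMapInv A q) (startMap A q y))
      fun v => DFunLike.congr_fun heq v
  exact LinearMap.injective_iff_surjective.1 hinj

theorem hasFDerivAt_homotopy (y₀ : State n) (p : State n × ℝ) :
    HasFDerivAt (fun u : State n × ℝ => H A q u.1 y₀ u.2)
      (fderiv ℝ (freePart A q) p -
        (ContinuousLinearMap.snd ℝ (State n) ℝ).smulRight (startMap A q y₀)) p := by
  simp only [H_eq_freePart_sub]
  exact ((contDiff_freePart (k := 1)).differentiable one_ne_zero p).hasFDerivAt.sub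
    ((ContinuousLinearMap.snd ℝ (State n) ℝ).hasFDerivAt.smul_const _)

theorem fderiv_homotopy_comp_inl (y₀ : State n) (p : State n × ℝ) :
    (fderiv ℝ (fun u : State n × ℝ => H A q u.1 y₀ u.2) p).comp
      (ContinuousLinearMap.inl ℝ (State n) ℝ) =
    (fderiv ℝ (freePart A q) p).comp (ContinuousLinearMap.inl ℝ (State n) ℝ) := by
  rw [(hasFDerivAt_homotopy y₀ p).fderiv]
  refine ContinuousLinearMap.ext fun v => ?_
  simp

theorem isAddHaarMeasure_volume_state : (volume : Measure (State n)).IsAddHaarMeasure := by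
  have : (volume : Measure ((Fin n → ℝ) × (Fin n → ℝ))).IsAddHaarMeasure := by
    exact Measure.prod.instIsAddHaarMeasure volume volume
  exact Measure.prod.instIsAddHaarMeasure volume volume

theorem ae_zeroIsRegularValue : ∀ᵐ y₀ : State n, y₀ ∈ F1 A q → ZeroIsRegularValue A q y₀ := by
  rcases (F1 A q).eq_empty_or_nonempty with he | ⟨y₁, hy₁⟩
  · simp [he]
  have := isAddHaarMeasure_volume_state (n := n)
  let h : State n × ℝ → ℝ := fun p =>
    ((fderiv ℝ (freePart A q) p).comp (ContinuousLinearMap.inl ℝ (State n) ℝ)).det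
  -- For λ > 0, H = 0 means that f takes the value `startMap` y₀.
  let f : State n × ℝ → State n := fun p => p.2⁻¹ • freePart A q p
  let S : Set (State n × ℝ) := {p | h p = 0 ∧ 0 < p.2 ∧ ¬ Function.Surjective (fderiv ℝ f p)}
  have hh : AnalyticOnNhd ℝ h univ := by
    refine contDiff_omega_iff_analyticOnNhd.1 (contDiff_clm_det.comp ?_)
    exact ((ContinuousLinearMap.compL ℝ (State n) (State n × ℝ) (State n)).flip
      (ContinuousLinearMap.inl ℝ (State n) ℝ)).contDiff.comp
      (contDiff_freePart.fderiv_right (m := ω) (n := ω) le_rfl)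
  have hnull : (volume : Measure (State n)) (f '' S) = 0 := by
    refine measure_image_critical_eq_zero volume ?_ hh
      ⟨(y₁, 1), det_fderiv_freePart_ne_zero hy₁⟩ (fun p hp => hp.1) ?_ fun p hp => hp.2.2
    · rw [Module.finrank_prod, Module.finrank_self]
    · intro p hp
      exact DifferentiableAt.smul ((differentiable_snd p).fun_inv hp.2.1.ne')
        ((contDiff_freePart (k := 1)).differentiable one_ne_zero p)
  have hnull' : (volume : Measure (State n)) (startMapInv A q '' (f '' S ∩ startTarget A q)) = 0 :=
    addHaar_image_eq_zero_of_differentiableOn_of_addHaar_eq_zero volume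
      (differentiableOn_startMapInv.mono inter_subset_right)
      (measure_mono_null inter_subset_left hnull)
  refine measure_mono_null ?_ hnull'
  intro y₀ hy₀
  rw [mem_compl_iff, mem_ofPred_eq, Classical.not_imp] at hy₀
  obtain ⟨hy₀F, hnot⟩ := hy₀
  unfold ZeroIsRegularValue at hnot
  push Not at hnot
  obtain ⟨p, ⟨⟨-, hp2, -⟩, hp0⟩, hns⟩ := hnot
  have hfp : f p = startMap A q y₀ := by
    have := hp0
    rw [H_eq_freePart_sub, sub_eq_zero] at this
    simp only [f, this, smul_smul, inv_mul_cancel₀ hp2.ne', one_smul]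
  refine ⟨startMap A q y₀, ⟨⟨p, ⟨?_, hp2, ?_⟩, hfp⟩, startMap_mem hy₀F⟩,
    startMapInv_startMap hy₀F⟩
  · by_contra hne
    have hs := clm_surjective_of_det_ne_zero hne
    rw [← fderiv_homotopy_comp_inl y₀] at hs
    exact hns (Function.Surjective.of_comp (g := ContinuousLinearMap.inl ℝ (State n) ℝ) hs)
  · have hH := ((contDiff_homotopy (A := A) (q := q) (k := 1) y₀).differentiable one_ne_zero
      p).hasFDerivAt
    have hinv : DifferentiableAt ℝ (fun u : State n × ℝ => u.2⁻¹) p :=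
      (differentiable_snd p).fun_inv hp2.ne'
    have hinv := hinv.hasFDerivAt
    -- Here f = λ⁻¹ • H + `startMap` y₀ near p. The term from differentiating λ⁻¹ carries the factor
    -- H = 0, so at p the derivatives of f and H are proportional.
    have hf : HasFDerivAt f
        (p.2⁻¹ • fderiv ℝ (fun u : State n × ℝ => H A q u.1 y₀ u.2) p) p := by
      have h1 := (hinv.smul hH).add_const (startMap A q y₀)
      simp only [hp0] at h1
      refine (h1.congr_of_eventuallyEq ?_).congr_fderiv ?_
      · filter_upwards [continuous_snd.continuousAt.eventually (lt_mem_nhds hp2)] with u hu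
        have hu : 0 < u.2 := hu
        simp only [f, H_eq_freePart_sub, smul_sub, Pi.smul_apply', smul_smul,
          inv_mul_cancel₀ hu.ne', one_smul, sub_add_cancel]
      · ext v <;> simp
    rw [hf.fderiv]
    intro hs
    refine hns fun w => ?_
    obtain ⟨v, hv⟩ := hs (p.2⁻¹ • w)
    exact ⟨v, smul_right_injective _ (inv_ne_zero hp2.ne') hv⟩

end LCP

/-! ### Boundedness and closedness of the zero set. -/

section Bounds

variable {n : ℕ} {A : Matrix (Fin n) (Fin n) ℝ} {q : Fin n → ℝ} {y₀ : State n}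

theorem complementarity_fst {y : State n} {l : ℝ} (h : H A q y y₀ l = 0) (i : Fin n) :
    y.2.1 i * y.1 i = l * (y₀.2.1 i * y₀.1 i) := by
  have := congrFun (congrArg (fun u : State n => u.2.1) h) i
  simpa [H, Matrix.mulVec_diagonal, sub_eq_zero] using this

theorem complementarity_snd {y : State n} {l : ℝ} (h : H A q y y₀ l = 0) (i : Fin n) :
    y.2.2 i * (A *ᵥ y.1 + q) i = l * (y₀.2.2 i * (A *ᵥ y₀.1 + q) i) := by
  have := congrFun (congrArg (fun u : State n => u.2.2) h) i
  simp only [H, Prod.snd_zero, Pi.zero_apply, Pi.sub_apply, Matrix.mulVec_diagonal, Pi.smul_apply,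
    smul_eq_mul, sub_eq_zero] at this
  exact this

/-- The first block of the homotopy equation, paired with a vector `d`. -/
theorem pairing_eq_zero {y : State n} {l : ℝ} (h : H A q y y₀ l = 0) (d : Fin n → ℝ) :
    (1 - l) * (d ⬝ᵥ (A *ᵥ y.1 + q) + (A *ᵥ d) ⬝ᵥ y.1 - d ⬝ᵥ y.2.1 - (A *ᵥ d) ⬝ᵥ y.2.2)
      + l * (d ⬝ᵥ (y.1 - y₀.1)) = 0 := by
  have h1 : (1 - l) • ((A + Aᵀ) *ᵥ y.1 + q - y.2.1 - Aᵀ *ᵥ y.2.2) + l • (y.1 - y₀.1) = 0 :=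
    congrArg Prod.fst h
  have h2 := congrArg (d ⬝ᵥ ·) h1
  have hT : ∀ v : Fin n → ℝ, d ⬝ᵥ (Aᵀ *ᵥ v) = (A *ᵥ d) ⬝ᵥ v := fun v => by
    rw [Matrix.dotProduct_mulVec, Matrix.vecMul_transpose]
  simp only [dotProduct_add, dotProduct_sub, dotProduct_smul, Matrix.add_mulVec, hT,
    dotProduct_zero, smul_eq_mul] at h2 ⊢
  linarith

theorem eq_start_of_level_one {y : State n} (hy : y ∈ F1 A q) (hy₀ : y₀ ∈ F1 A q)
    (h : H A q y y₀ 1 = 0) : y = y₀ := by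
  rw [H_eq_freePart_sub, freePart_one, one_smul, sub_eq_zero] at h
  rw [← startMapInv_startMap hy, h, startMapInv_startMap hy₀]

theorem dotProduct_fst_eq {y : State n} {l : ℝ} (hy : y ∈ F1 A q) (h : H A q y y₀ l = 0)
    (d : Fin n → ℝ) : d ⬝ᵥ y.2.1 = l * ∑ i, d i * (y₀.2.1 i * y₀.1 i / y.1 i) := by
  rw [dotProduct, Finset.mul_sum]
  refine Finset.sum_congr rfl fun i _ => ?_
  have hx := (hy.1 i).ne'
  rw [mul_left_comm, ← mul_div_assoc, ← complementarity_fst h, mul_div_cancel_right₀ _ hx]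

theorem dotProduct_snd_eq {y : State n} {l : ℝ} (hy : y ∈ F1 A q) (h : H A q y y₀ l = 0)
    (d : Fin n → ℝ) : d ⬝ᵥ y.2.2 =
      l * ∑ i, d i * (y₀.2.2 i * (A *ᵥ y₀.1 + q) i / (A *ᵥ y.1 + q) i) := by
  rw [dotProduct, Finset.mul_sum]
  refine Finset.sum_congr rfl fun i _ => ?_
  have hx := (hy.2.1 i).ne'
  rw [mul_left_comm, ← mul_div_assoc, ← complementarity_snd h, mul_div_cancel_right₀ _ hx]

/-- Along a recession direction `d` of the feasible set, `d ⬝ᵥ x` is controlled by the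
complementarity terms. -/
theorem dotProduct_sub_le {p : State n × ℝ} (hy₀ : y₀ ∈ F1 A q) (hp : p ∈ zeroSet A q y₀)
    {d : Fin n → ℝ} (hd : ∀ i, 0 ≤ d i) (hAd : ∀ i, 0 ≤ (A *ᵥ d) i) :
    d ⬝ᵥ p.1.1 - d ⬝ᵥ y₀.1 ≤ ∑ i, d i * (y₀.2.1 i * y₀.1 i / p.1.1 i) +
      ∑ i, (A *ᵥ d) i * (y₀.2.2 i * (A *ᵥ y₀.1 + q) i / (A *ᵥ p.1.1 + q) i) := by
  obtain ⟨⟨hpF, hl0, hl1⟩, hpH⟩ := hp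
  have hpair := pairing_eq_zero hpH d
  rw [dotProduct_fst_eq hpF hpH, dotProduct_snd_eq hpF hpH, dotProduct_sub] at hpair
  obtain ⟨hx0, hw0, hz0, hz0'⟩ := hy₀
  obtain ⟨hx, hw, -, -⟩ := hpF
  have h1 : 0 ≤ d ⬝ᵥ (A *ᵥ p.1.1 + q) :=
    Finset.sum_nonneg fun i _ => mul_nonneg (hd i) (hw i).le
  have h2 : 0 ≤ (A *ᵥ d) ⬝ᵥ p.1.1 :=
    Finset.sum_nonneg fun i _ => mul_nonneg (hAd i) (hx i).le
  have h3 : 0 ≤ ∑ i, d i * (y₀.2.1 i * y₀.1 i / p.1.1 i) := Finset.sum_nonneg fun i _ =>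
    mul_nonneg (hd i) (div_nonneg (mul_nonneg (hz0 i).le (hx0 i).le) (hx i).le)
  have h4 : 0 ≤ ∑ i, (A *ᵥ d) i * (y₀.2.2 i * (A *ᵥ y₀.1 + q) i / (A *ᵥ p.1.1 + q) i) :=
    Finset.sum_nonneg fun i _ =>
      mul_nonneg (hAd i) (div_nonneg (mul_nonneg (hz0' i).le (hw0 i).le) (hw i).le)
  generalize ∑ i, d i * (y₀.2.1 i * y₀.1 i / p.1.1 i) = s at *
  generalize ∑ i, (A *ᵥ d) i * (y₀.2.2 i * (A *ᵥ y₀.1 + q) i / (A *ᵥ p.1.1 + q) i) = t at *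
  generalize d ⬝ᵥ (A *ᵥ p.1.1 + q) = a at *
  generalize (A *ᵥ d) ⬝ᵥ p.1.1 = b at *
  have h5 : 0 ≤ (1 - p.2) * (a + b) := mul_nonneg (sub_nonneg.2 hl1) (add_nonneg h1 h2)
  have h6 : 0 ≤ p.2 * p.2 * (s + t) :=
    mul_nonneg (mul_nonneg hl0.le hl0.le) (add_nonneg h3 h4)
  -- The multiplier terms sum to (1 − λ)λ(s + t) ≤ λ(s + t), so λ cancels and the bound is uniform
  -- as λ → 0.
  have h7 : p.2 * (d ⬝ᵥ p.1.1 - d ⬝ᵥ y₀.1) ≤ p.2 * (s + t) := by linarith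
  exact le_of_mul_le_mul_left h7 hl0

/-- If d = 0 the term is identically 0; if d > 0 then s grows like r • d and the quotient dies. -/
theorem tendsto_mul_div_zero {r v s : ℕ → ℝ} {d a : ℝ} (hr : Tendsto r atTop atTop)
    (hv : Tendsto v atTop (𝓝 d)) (hd : 0 ≤ d) (hs : ∀ k, s k = r k * v k) :
    Tendsto (fun k => d * (a / s k)) atTop (𝓝 0) := by
  rcases hd.eq_or_lt with h | h
  · simp [← h]
  · have : Tendsto s atTop atTop := by
      rw [show s = fun k => r k * v k from funext hs]
      exact hr.atTop_mul_pos h hv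
    simpa using (this.const_div_atTop a).const_mul d

/-- Otherwise normalized x's converge to a recession direction d ≠ 0. In `dotProduct_sub_le` the
left side then grows like ‖x‖ (d ⬝ᵥ d), while the right side tends to 0. -/
theorem exists_norm_fst_le (hy₀ : y₀ ∈ F1 A q) :
    ∃ R, ∀ p ∈ zeroSet A q y₀, ‖p.1.1‖ ≤ R := by
  by_contra! hcon
  choose p hp hpn using fun k : ℕ => hcon (k + 1)
  have hpos : ∀ k, 0 < ‖(p k).1.1‖ := fun k =>
    lt_of_le_of_lt (by positivity) (hpn k)
  have hu : ∀ k, ‖(p k).1.1‖⁻¹ • (p k).1.1 ∈ Metric.sphere (0 : Fin n → ℝ) 1 := by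
    intro k
    rw [mem_sphere_zero_iff_norm, norm_smul, norm_inv, norm_norm, inv_mul_cancel₀ (hpos k).ne']
  obtain ⟨d, hd1, φ, hφ, hlim⟩ := (isCompact_sphere (0 : Fin n → ℝ) 1).tendsto_subseq hu
  let r : ℕ → ℝ := fun k => ‖(p (φ k)).1.1‖
  let u : ℕ → Fin n → ℝ := fun k => (r k)⁻¹ • (p (φ k)).1.1
  have hr0 : ∀ k, 0 < r k := fun k => hpos _
  have hr : Tendsto r atTop atTop := by
    refine tendsto_atTop_mono (fun k => ?_) tendsto_natCast_atTop_atTop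
    have h1 : (k : ℝ) ≤ φ k := by exact_mod_cast hφ.id_le k
    have h2 := hpn (φ k)
    change (k : ℝ) ≤ ‖(p (φ k)).1.1‖
    linarith
  have hlim : Tendsto u atTop (𝓝 d) := hlim
  have hxu : ∀ k, (p (φ k)).1.1 = r k • u k := fun k => by
    simp [u, smul_smul, mul_inv_cancel₀ (hr0 k).ne']
  let w : ℕ → Fin n → ℝ := fun k => A *ᵥ u k + (r k)⁻¹ • q
  have hw : Tendsto w atTop (𝓝 (A *ᵥ d)) := by
    have h1 : Continuous fun v : Fin n → ℝ => A *ᵥ v :=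
      (contDiff_mulVec A contDiff_id (k := 0)).continuous
    have h2 : Tendsto (fun k => (r k)⁻¹ • q) atTop (𝓝 ((0 : ℝ) • q)) :=
      hr.inv_tendsto_atTop.smul_const q
    simpa using (h1.continuousAt.tendsto.comp hlim).add h2
  have hww : ∀ k, A *ᵥ (p (φ k)).1.1 + q = r k • w k := fun k => by
    simp only [w, smul_add, smul_smul, mul_inv_cancel₀ (hr0 k).ne', one_smul]
    rw [hxu k, Matrix.mulVec_smul]
  have hui := tendsto_pi_nhds.1 hlim
  have hwi := tendsto_pi_nhds.1 hw
  have hd : ∀ i, 0 ≤ d i := fun i => ge_of_tendsto' (hui i) fun k => by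
    have h1 := (hp (φ k)).1.1.1 i
    rw [hxu k, Pi.smul_apply, smul_eq_mul] at h1
    exact (pos_of_mul_pos_right h1 (hr0 k).le).le
  have hAd : ∀ i, 0 ≤ (A *ᵥ d) i := fun i => ge_of_tendsto' (hwi i) fun k => by
    have h1 := (hp (φ k)).1.1.2.1 i
    rw [hww k, Pi.smul_apply, smul_eq_mul] at h1
    exact (pos_of_mul_pos_right h1 (hr0 k).le).le
  have hdd : 0 < d ⬝ᵥ d := by
    obtain ⟨i, hi⟩ : ∃ i, d i ≠ 0 := by
      by_contra! h
      have h0 : d = 0 := funext h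
      rw [h0, mem_sphere_zero_iff_norm, norm_zero] at hd1
      exact zero_ne_one hd1
    exact Finset.sum_pos' (fun j _ => mul_self_nonneg _) ⟨i, Finset.mem_univ _, mul_self_pos.2 hi⟩
  have hL : Tendsto (fun k => d ⬝ᵥ (p (φ k)).1.1 - d ⬝ᵥ y₀.1) atTop atTop := by
    refine tendsto_atTop_add_const_right _ _ ?_
    have h1 : Tendsto (fun k => d ⬝ᵥ u k) atTop (𝓝 (d ⬝ᵥ d)) :=
      tendsto_finsetSum _ fun i _ => (hui i).const_mul _
    refine (hr.atTop_mul_pos hdd h1).congr fun k => ?_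
    exact ((congrArg (d ⬝ᵥ ·) (hxu k)).trans (dotProduct_smul (r k) d (u k))).symm
  have hR : Tendsto (fun k => ∑ i, d i * (y₀.2.1 i * y₀.1 i / (p (φ k)).1.1 i) +
      ∑ i, (A *ᵥ d) i * (y₀.2.2 i * (A *ᵥ y₀.1 + q) i / (A *ᵥ (p (φ k)).1.1 + q) i))
      atTop (𝓝 0) := by
    have h1 := tendsto_finsetSum Finset.univ fun i _ => tendsto_mul_div_zero
      (s := fun k => (p (φ k)).1.1 i) (a := y₀.2.1 i * y₀.1 i) hr (hui i) (hd i)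
      fun k => congrFun (hxu k) i
    have h2 := tendsto_finsetSum Finset.univ fun i _ => tendsto_mul_div_zero
      (s := fun k => (A *ᵥ (p (φ k)).1.1 + q) i) (a := y₀.2.2 i * (A *ᵥ y₀.1 + q) i)
      hr (hwi i) (hAd i) fun k => congrFun (hww k) i
    simpa using h1.add h2
  obtain ⟨k, hk1, hk2⟩ :=
    ((hL.eventually_gt_atTop 1).and (hR.eventually (gt_mem_nhds one_pos))).exists
  have := dotProduct_sub_le hy₀ (hp (φ k)) hd hAd
  linarith

/-- Pair the first block with x − x⁰. The term λ‖x − x⁰‖² (Euclidean norm) is nonnegative, so the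
bracket multiplied by 1 − λ > 0 is at most 0. Expand it, use complementarity, and drop x ⬝ᵥ (A x +
q) ≥ 0. -/
theorem dotProduct_multipliers_le {p : State n × ℝ} (hy₀ : y₀ ∈ F1 A q)
    (hp : p ∈ zeroSet A q y₀) (hp1 : p.2 < 1) :
    y₀.1 ⬝ᵥ p.1.2.1 + (A *ᵥ y₀.1 + q) ⬝ᵥ p.1.2.2 ≤
      ∑ i, y₀.2.1 i * y₀.1 i + ∑ i, y₀.2.2 i * (A *ᵥ y₀.1 + q) i +
        (y₀.1 ⬝ᵥ (A *ᵥ p.1.1 + q) + (A *ᵥ y₀.1 + q) ⬝ᵥ p.1.1) := by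
  obtain ⟨⟨⟨hx, hw, -, -⟩, hl0, -⟩, hpH⟩ := hp
  obtain ⟨hx0, hw0, hz0, hz0'⟩ := hy₀
  have hpair := pairing_eq_zero hpH (p.1.1 - y₀.1)
  have hA : A *ᵥ (p.1.1 - y₀.1) = (A *ᵥ p.1.1 + q) - (A *ᵥ y₀.1 + q) := by
    rw [Matrix.mulVec_sub]; abel
  have hcs : p.1.1 ⬝ᵥ p.1.2.1 = p.2 * ∑ i, y₀.2.1 i * y₀.1 i := by
    rw [dotProduct, Finset.mul_sum]
    exact Finset.sum_congr rfl fun i _ => by rw [← complementarity_fst hpH, mul_comm]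
  have hcs' : (A *ᵥ p.1.1 + q) ⬝ᵥ p.1.2.2 = p.2 * ∑ i, y₀.2.2 i * (A *ᵥ y₀.1 + q) i := by
    rw [dotProduct, Finset.mul_sum]
    exact Finset.sum_congr rfl fun i _ => by rw [← complementarity_snd hpH, mul_comm]
  have hs1 : 0 ≤ ∑ i, y₀.2.1 i * y₀.1 i :=
    Finset.sum_nonneg fun i _ => mul_nonneg (hz0 i).le (hx0 i).le
  have hs2 : 0 ≤ ∑ i, y₀.2.2 i * (A *ᵥ y₀.1 + q) i :=
    Finset.sum_nonneg fun i _ => mul_nonneg (hz0' i).le (hw0 i).le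
  have hxw : 0 ≤ p.1.1 ⬝ᵥ (A *ᵥ p.1.1 + q) :=
    Finset.sum_nonneg fun i _ => mul_nonneg (hx i).le (hw i).le
  have hsq : 0 ≤ (p.1.1 - y₀.1) ⬝ᵥ (p.1.1 - y₀.1) :=
    Finset.sum_nonneg fun i _ => mul_self_nonneg _
  rw [hA] at hpair
  generalize (p.1.1 - y₀.1) ⬝ᵥ (p.1.1 - y₀.1) = c at *
  simp only [sub_dotProduct, hcs, hcs'] at hpair
  rw [dotProduct_comm _ p.1.1] at hpair
  have hle : ∀ e : ℝ, (1 - p.2) * e + p.2 * c = 0 → e ≤ 0 := by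
    intro e he
    by_contra! h
    have := mul_pos (sub_pos.2 hp1) h
    have := mul_nonneg hl0.le hsq
    linarith
  have hfin := hle _ hpair
  have h1 := mul_le_of_le_one_left hs1 hp1.le
  have h2 := mul_le_of_le_one_left hs2 hp1.le
  linarith

theorem isBounded_zeroSet (hy₀ : y₀ ∈ F1 A q) : Bornology.IsBounded (zeroSet A q y₀) := by
  obtain ⟨R, hR⟩ := exists_norm_fst_le hy₀
  have hcont : Continuous fun x : Fin n → ℝ =>
      ∑ i, y₀.2.1 i * y₀.1 i + ∑ i, y₀.2.2 i * (A *ᵥ y₀.1 + q) i +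
        (y₀.1 ⬝ᵥ (A *ᵥ x + q) + (A *ᵥ y₀.1 + q) ⬝ᵥ x) := by
    have h1 : Continuous fun v : Fin n → ℝ => A *ᵥ v :=
      (contDiff_mulVec A contDiff_id (k := 0)).continuous
    exact continuous_const.add ((continuous_const.dotProduct (h1.add continuous_const)).add
      (continuous_const.dotProduct continuous_id))
  obtain ⟨M, hM⟩ := (isCompact_closedBall (0 : Fin n → ℝ) R).bddAbove_image hcont.continuousOn
  -- The multiplier bound needs λ < 1; level 1 adds only the starting point. The weights `y₀.1 i`
  -- and `(A *ᵥ y₀.1 + q) i` are positive, so each multiplier coordinate is bounded.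
  have hsub : zeroSet A q y₀ ⊆ Icc (((0, 0, 0), 0) : State n × ℝ)
      ((fun _ => R, fun i => M / y₀.1 i, fun i => M / (A *ᵥ y₀.1 + q) i), 1) ∪ {(y₀, 1)} := by
    intro p hp
    obtain ⟨⟨hpF, hl0, hl1⟩, hpH⟩ := id hp
    rcases hl1.lt_or_eq with h | h
    · left
      have hb := (dotProduct_multipliers_le hy₀ hp h).trans
        (hM ⟨p.1.1, by simpa using hR p hp, rfl⟩)
      obtain ⟨hx, hw, hz, hz'⟩ := hpF
      have hn1 : ∀ i, 0 ≤ y₀.1 i * p.1.2.1 i := fun i => mul_nonneg (hy₀.1 i).le (hz i).le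
      have hn2 : ∀ i, 0 ≤ (A *ᵥ y₀.1 + q) i * p.1.2.2 i := fun i =>
        mul_nonneg (hy₀.2.1 i).le (hz' i).le
      have hs1 : 0 ≤ y₀.1 ⬝ᵥ p.1.2.1 := Finset.sum_nonneg fun i _ => hn1 i
      have hs2 : 0 ≤ (A *ᵥ y₀.1 + q) ⬝ᵥ p.1.2.2 := Finset.sum_nonneg fun i _ => hn2 i
      refine ⟨⟨⟨fun i => (hx i).le, fun i => (hz i).le, fun i => (hz' i).le⟩, hl0.le⟩,
        ⟨⟨fun i => ?_, fun i => ?_, fun i => ?_⟩, hl1⟩⟩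
      · exact (le_abs_self _).trans ((norm_le_pi_norm p.1.1 i).trans (hR p hp))
      · have := Finset.single_le_sum (fun j _ => hn1 j) (Finset.mem_univ i)
        change p.1.2.1 i ≤ M / y₀.1 i
        rw [le_div_iff₀ (hy₀.1 i), mul_comm]
        exact this.trans (by linarith [show ∑ j, y₀.1 j * p.1.2.1 j = y₀.1 ⬝ᵥ p.1.2.1 from rfl])
      · have := Finset.single_le_sum (fun j _ => hn2 j) (Finset.mem_univ i)
        change p.1.2.2 i ≤ M / (A *ᵥ y₀.1 + q) i
        rw [le_div_iff₀ (hy₀.2.1 i), mul_comm]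
        exact this.trans (by linarith [show ∑ j, (A *ᵥ y₀.1 + q) j * p.1.2.2 j =
          (A *ᵥ y₀.1 + q) ⬝ᵥ p.1.2.2 from rfl])
    · right
      rw [h] at hpH
      exact Prod.ext (eq_start_of_level_one hpF hy₀ hpH) h
  exact (isCompact_Icc.isBounded.union Bornology.isBounded_singleton).subset hsub

theorem isClosed_zeros (y₀ : State n) :
    IsClosed {p : State n × ℝ | p.1 ∈ F1bar A q ∧ p.2 ≤ 1 ∧ H A q p.1 y₀ p.2 = 0} :=
  (isClosed_F1bar.preimage continuous_fst).inter
    ((isClosed_le continuous_snd continuous_const).inter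
      (isClosed_eq (contDiff_homotopy y₀ (k := 0)).continuous continuous_const))

theorem zeroSet_subset : zeroSet A q y₀ ⊆
    {p : State n × ℝ | p.1 ∈ F1bar A q ∧ p.2 ≤ 1 ∧ H A q p.1 y₀ p.2 = 0} := by
  rintro p ⟨⟨⟨h1, h2, h3, h4⟩, -, hl⟩, hH⟩
  exact ⟨⟨fun i => (h1 i).le, fun i => (h2 i).le, fun i => (h3 i).le, fun i => (h4 i).le⟩, hl, hH⟩

/-- While λ > 0 the complementarity products stay positive, so no coordinate of x, A x + q, z₁ or z₂
can degenerate to 0 in the limit. -/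
theorem mem_zeroSet_of_mem_closure (hy₀ : y₀ ∈ F1 A q) {p : State n × ℝ}
    (hp : p ∈ closure (zeroSet A q y₀)) (hp2 : 0 < p.2) : p ∈ zeroSet A q y₀ := by
  obtain ⟨⟨h1, h2, h3, h4⟩, hl, hH⟩ := closure_minimal zeroSet_subset (isClosed_zeros y₀) hp
  obtain ⟨hx0, hw0, hz0, hz0'⟩ := hy₀
  have e1 : ∀ i, 0 < p.1.2.1 i * p.1.1 i := fun i => by
    rw [complementarity_fst hH]
    exact mul_pos hp2 (mul_pos (hz0 i) (hx0 i))
  have e2 : ∀ i, 0 < p.1.2.2 i * (A *ᵥ p.1.1 + q) i := fun i => by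
    rw [complementarity_snd hH]
    exact mul_pos hp2 (mul_pos (hz0' i) (hw0 i))
  exact ⟨⟨⟨fun i => pos_of_mul_pos_right (e1 i) (h3 i), fun i => pos_of_mul_pos_right (e2 i) (h4 i),
    fun i => pos_of_mul_pos_left (e1 i) (h1 i), fun i => pos_of_mul_pos_left (e2 i) (h2 i)⟩,
    hp2, hl⟩, hH⟩

theorem solvesSystem_of_level_zero {y : State n} (h : H A q y y₀ 0 = 0) : SolvesSystem A q y := by
  have h1 := congrArg Prod.fst h
  have h2 := congrArg (fun u : State n => u.2.1) h
  have h3 := congrArg (fun u : State n => u.2.2) h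
  simp only [H, sub_zero, one_smul, zero_smul, add_zero] at h1 h2 h3
  exact ⟨h1, h2, h3⟩

end Bounds

end LCPHomotopy

/-! ### Assembly: the curve and its limit set. -/

theorem theorem3p4 (n : ℕ) (A : Matrix (Fin n) (Fin n) ℝ) (q : Fin n → ℝ) :
    (∀ᵐ y₀ : LCPHomotopy.State n,
      y₀ ∈ LCPHomotopy.F1 A q → LCPHomotopy.ZeroIsRegularValue A q y₀) ∧
    ∀ y₀ ∈ LCPHomotopy.F1 A q, LCPHomotopy.ZeroIsRegularValue A q y₀ →
      ∃ γ : ℝ → LCPHomotopy.State n × ℝ,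
        LCPHomotopy.IsSmoothCurve γ ∧
        (∀ s ∈ Ici (0 : ℝ), γ s ∈ LCPHomotopy.zeroSet A q y₀) ∧
        γ 0 = (y₀, 1) ∧
        Bornology.IsBounded (γ '' Ici 0) ∧
        Tendsto (fun s => (γ s).2) atTop (𝓝 0) ∧
        ∃ L : Set (LCPHomotopy.State n),
          LCPHomotopy.limitSet γ = L ×ˢ {(0 : ℝ)} ∧
          L.Nonempty ∧
          L ⊆ LCPHomotopy.F1bar A q ∧
          ∀ y ∈ L, LCPHomotopy.SolvesSystem A q y := by
  refine ⟨LCPHomotopy.ae_zeroIsRegularValue, fun y₀ hy₀ hreg => ?_⟩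
  have hstart : ((y₀, 1) : LCPHomotopy.State n × ℝ) ∈ LCPHomotopy.zeroSet A q y₀ := by
    refine ⟨⟨hy₀, one_pos, le_rfl⟩, ?_⟩
    rw [LCPHomotopy.H_eq_freePart_sub, LCPHomotopy.freePart_one, one_smul, sub_self]
  have hbdd := LCPHomotopy.isBounded_zeroSet hy₀
  obtain ⟨γ, hcd, hinj, hderiv, hmem, hγ0, hlim⟩ := LCPHomotopy.exists_zero_path
    (LCPHomotopy.contDiff_homotopy (A := A) (q := q) y₀) LCPHomotopy.isOpen_F1
    (Z := LCPHomotopy.zeroSet A q y₀)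
    (fun p => ⟨fun h => ⟨h.1.1, h.1.2.1, h.1.2.2, h.2⟩, fun h => ⟨⟨h.1, h.2.1, h.2.2.1⟩, h.2.2.2⟩⟩)
    hstart rfl
    (fun p hp hp1 => Prod.ext
      (LCPHomotopy.eq_start_of_level_one hp.1.1 hy₀ (hp1 ▸ hp.2)) hp1)
    hreg
    (by rw [LCPHomotopy.fderiv_homotopy_comp_inl]
        exact LCPHomotopy.det_fderiv_freePart_ne_zero hy₀)
    hbdd fun p hp hp2 => LCPHomotopy.mem_zeroSet_of_mem_closure hy₀ hp hp2
  have hbddγ : Bornology.IsBounded (γ '' Ici 0) := hbdd.subset (image_subset_iff.2 hmem)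
  have hlevel : ∀ p ∈ LCPHomotopy.limitSet γ, p.2 = 0 := by
    intro p hp
    have h1 : MapClusterPt p.2 atTop (fun s => (γ s).2) := hp.continuousAt_comp continuousAt_snd
    have h2 : ClusterPt p.2 (𝓝 0) := ClusterPt.mono h1 hlim
    exact eq_of_nhds_neBot h2
  -- The closed set used here allows λ = 0, so H = 0 and the weak inequalities survive in the limit.
  have hlimmem : ∀ p ∈ LCPHomotopy.limitSet γ,
      p ∈ {p : LCPHomotopy.State n × ℝ |
        p.1 ∈ LCPHomotopy.F1bar A q ∧ p.2 ≤ 1 ∧ LCPHomotopy.H A q p.1 y₀ p.2 = 0} := fun p hp =>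
    (LCPHomotopy.isClosed_zeros y₀).mem_of_mapClusterPt hp
      ((eventually_ge_atTop 0).mono fun s hs => LCPHomotopy.zeroSet_subset (hmem s hs))
  refine ⟨γ, ⟨hcd.contDiffOn, hinj, fun s hs => ?_⟩, hmem, hγ0, hbddγ, hlim,
    {y | (y, 0) ∈ LCPHomotopy.limitSet γ}, ?_, ?_, ?_, ?_⟩
  · rw [(hcd.differentiable (by simp) s).derivWithin (uniqueDiffOn_Ici 0 s hs)]
    exact hderiv s hs
  · ext ⟨y, l⟩
    constructor
    · intro h
      have h0 : l = 0 := hlevel _ h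
      exact ⟨h0 ▸ h, h0⟩
    · rintro ⟨h, h0⟩
      have h0 : l = 0 := h0
      rw [h0]
      exact h
  · obtain ⟨⟨y, l⟩, -, hp⟩ := hbddγ.isCompact_closure.exists_mapClusterPt_of_frequently
      (l := atTop) (f := γ) ((eventually_ge_atTop 0).mono fun s hs =>
        subset_closure (mem_image_of_mem γ hs)).frequently
    have h0 : l = 0 := hlevel _ hp
    exact ⟨y, h0 ▸ hp⟩
  · exact fun y hy => (hlimmem _ hy).1
  · exact fun y hy => LCPHomotopy.solvesSystem_of_level_zero (hlimmem _ hy).2.2
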